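/- **Setting.** Let $(\Omega,\mathcal F,\mathbb P,(\mathcal F_t)_{t\ge 0})$ be a complete filtered probability space satisfying the usual conditions and supporting a standard Wiener process $W$; let $\mu,\sigma:[0,\infty)\to\mathbb R$ be measurable, $r>0$, let $g:[0,\infty)\to(0,\infty)$ be right-continuous with left limits, and put $G(x)=\int_0^x g(u)\,du$. An *admissible strategy* $D\in\mathbb L$ consists of a measurable rate $\lambda:[0,\infty)\to[0,\infty)$; a set $B\subseteq[0,\infty)$ that is a finite union of closed connected sets; a measurable $\mathcal J:[0,\infty)\to[0,\infty)$ with $\mathcal J(x)\le x$ for all $x\ge0$, $\mathcal J=0$ off $B$ and $\mathcal J>0$ on $\mathrm{Int}(B)$ (the interior in $\mathbb R$); and finitely many skew points $x_j\in(0,\infty)\setminus\mathrm{Int}(B)$ with intensities $c_j\in(0,1]$, $j=1,\dots,n$ ($n\ge 0$). For $(D^1,D^2)\in\mathbb L\times\mathbb L$, with $D^i$ given by $\lambda^i,B^i,\mathcal J^i,(x^i_j),(c^i_j)$, and $x\ge0$, the state $X$ solves, up to $\tau=\inf\{t\ge0:X_t\le0\}$ (and is stopped there), $$dX_t=\mu(X_t)\,dt+\sigma(X_t)\,dW_t-dD^1_t-dD^2_t,\qquad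 X_{0-}=x,$$ $$dD^i_t=\lambda^i(X_t)\,dt+\sum_{j}c^i_j\,dL^{x^i_j}_t(X)+\sum_{k\ge0}\mathcal J^i\big(\alpha^k(X_{t-})\big),\qquad D^i_{0-}=0,$$ where the last term denotes the jump of $D^i$ at time $t$, $L^y(X)$ is the symmetric local time, $\alpha(x)=(x-\mathcal J^1(x)-\mathcal J^2(x))\vee0$ and $\alpha^k$ is its $k$-fold iterate. If this equation has a unique strong solution, the expected reward of player $i$ is $$J_i(x;D^1,D^2)=\mathbb E\Big[\int_0^\tau e^{-rt}\tfrac{g(X_{t-})+g(X_{t-}-)}2\,d(D^i_t)^c+\sum_{0\le t\le\tau}e^{-rt}\tfrac{\Delta D^i_t}{\Delta D^1_t+\Delta D^2_t}\Big(G(X_{t-})-G\big((X_{t-}-\Delta D^1_t-\Delta D^2_t)\vee0\big)\Big)\Big],$$ where $(D^i)^c$ is the continuous part of $D^i$, $\Delta D^i_t$ is its jump at time $t$ (with $D^i_{0-}=0$), $g(y-)$ is the left limit of $g$ at $y$, and the sum runs over the times with $\Delta D^1_t+\Delta D^2_t>0$; otherwise $J_i(x;D^1,D^2)=-\infty$.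 The pair $(D^1,D^2)$ is a *global Markovian Nash equilibrium* if $J_1(x;D^1,D^2)\ge J_1(x;D,D^2)$ and $J_2(x;D^1,D^2)\ge J_2(x;D^1,D)$ for all $D\in\mathbb L$ and all $x\ge0$. **Theorem.** Let $(D^1,D^2)\in\mathbb L\times\mathbb L$ satisfy $B^i=[0,\infty)$ and $\mathcal J^i(x)=x$ for all $x\ge0$ and $i=1,2$. Then for every $x\ge0$ the state equation has a unique strong solution, and $D^1_0=D^2_0=x$ and $\tau=0$ almost surely; the pair $(D^1,D^2)$ is a global Markovian Nash equilibrium; and its equilibrium values are $$J_1(x;D^1,D^2)=J_2(x;D^1,D^2)=V(x)=\frac{G(x)}2,\qquad x\ge0.$$ -/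

import Mathlib

open MeasureTheory ProbabilityTheory Filter Topology Set
open scoped NNReal ENNReal

noncomputable section

namespace ExtractionGame

/-! ### Path functionals -/

/-- Right-continuous with left limits, for a path indexed by `[0, ∞)`
(at `t = 0` the condition on the left limit is void). -/
def IsRCLL (f : ℝ≥0 → ℝ) : Prop :=
  ∀ t, ContinuousWithinAt f (Ici t) t ∧ ∃ l, Tendsto f (𝓝[<] t) (𝓝 l)

/-- The left limit `f (t-)`, with the prescribed value `a` for `f (0-)`. -/
def leftVal (a : ℝ) (f : ℝ≥0 → ℝ) (t : ℝ≥0) : ℝ :=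
  if t = 0 then a else Function.leftLim f t

/-- The absorption time `τ = inf {t ≥ 0 : f t ≤ 0}`, which is `∞` if the path stays positive. -/
def absorptionTime (f : ℝ≥0 → ℝ) : ℝ≥0∞ := ⨅ (t : ℝ≥0) (_ : f t ≤ 0), (t : ℝ≥0∞)

/-- The time `t ∧ τ`. -/
def stopAt (f : ℝ≥0 → ℝ) (t : ℝ≥0) : ℝ≥0 := (min (t : ℝ≥0∞) (absorptionTime f)).toNNReal

/-- Lebesgue measure on the time axis `[0, ∞)`. -/
def leb : Measure ℝ≥0 := (volume : Measure ℝ).comap ((↑) : ℝ≥0 → ℝ)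

open scoped Classical in
/-- The Lebesgue-Stieltjes measure on `[0, ∞)` of a non-decreasing path; it does not charge `0`.
(Value `0` if the path is not monotone.) -/
def lsMeasure (f : ℝ≥0 → ℝ) : Measure ℝ≥0 :=
  if h : Monotone f then h.stieltjesFunction.measure else 0

/-! ### Brownian motion, stochastic integral, local time -/

section Stochastic

variable {Ω : Type*} {m : MeasurableSpace Ω}

/-- `W` is a standard Wiener process relative to the filtration `ℱ`. -/
structure IsWiener (P : Measure Ω) (ℱ : Filtration ℝ≥0 m) (W : ℝ≥0 → Ω → ℝ) : Prop where
  isBrownian : IsBrownianReal W P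
  adapted : Adapted ℱ W
  indep_increment : ∀ s t : ℝ≥0, s ≤ t →
    Indep (ℱ s) (MeasurableSpace.comap (fun ω => W t ω - W s ω) inferInstance) P

/-- Simple predictable integrands `∑_{k < n} ξ_k 1_{(t_k, t_{k+1}]}` with `ξ_k` bounded and
`ℱ_{t_k}`-measurable. -/
structure SimpleIntegrand (ℱ : Filtration ℝ≥0 m) where
  n : ℕ
  time : ℕ → ℝ≥0
  time_mono : Monotone time
  coeff : ℕ → Ω → ℝ
  coeff_measurable : ∀ k, Measurable[ℱ (time k)] (coeff k)
  coeff_bounded : ∃ C : ℝ, ∀ k ω, |coeff k ω| ≤ C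

/-- The value of a simple integrand at `(t, ω)`. -/
def SimpleIntegrand.value {ℱ : Filtration ℝ≥0 m} (S : SimpleIntegrand ℱ) (t : ℝ≥0) (ω : Ω) : ℝ :=
  ∑ k ∈ Finset.range S.n, (Ioc (S.time k) (S.time (k + 1))).indicator (fun _ => S.coeff k ω) t

/-- The elementary stochastic integral of a simple integrand over `(0, t]`. -/
def SimpleIntegrand.integral {ℱ : Filtration ℝ≥0 m} (S : SimpleIntegrand ℱ) (W : ℝ≥0 → Ω → ℝ)
    (t : ℝ≥0) (ω : Ω) : ℝ :=
  ∑ k ∈ Finset.range S.n,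
    S.coeff k ω * (W (min t (S.time (k + 1))) ω - W (min t (S.time k)) ω)

/-- `I` is the Itô integral `I_t = ∫_0^t H_s dW_s`: a continuous adapted process which is, locally
uniformly in time and in probability, the limit of the elementary integrals of simple integrands
`S n` with `∫_0^T |S n - H|² ds → 0` in probability for all `T`.
(This forces `∫_0^T H² ds < ∞` almost surely.) -/
def IsItoIntegral (P : Measure Ω) (ℱ : Filtration ℝ≥0 m) (W H I : ℝ≥0 → Ω → ℝ) : Prop :=
  Adapted ℱ I ∧ (∀ᵐ ω ∂P, Continuous (fun t => I t ω) ∧ I 0 ω = 0) ∧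
  ∃ S : ℕ → SimpleIntegrand ℱ, ∀ T : ℝ≥0,
    (∀ ε : ℝ≥0∞, 0 < ε → Tendsto
      (fun n => P {ω | ε ≤ ∫⁻ s in Iic T, ‖(S n).value s ω - H s ω‖ₑ ^ 2 ∂leb}) atTop (𝓝 0)) ∧
    (∀ ε : ℝ, 0 < ε → Tendsto
      (fun n => P {ω | ∃ t ≤ T, ε ≤ |(S n).integral W t ω - I t ω|}) atTop (𝓝 0))

/-- `A` is the continuous part of the quadratic variation of `X` on `[0, ∞)`: the limit in
probability of sums of squared increments equals `A t + ∑_{0 < s ≤ t} (ΔX_s)²`. -/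
def IsContQuadVar (P : Measure Ω) (X A : ℝ≥0 → Ω → ℝ) : Prop :=
  (∀ᵐ ω ∂P, Monotone (fun t => A t ω) ∧ Continuous (fun t => A t ω) ∧ A 0 ω = 0) ∧
  (∀ᵐ ω ∂P, ∀ t : ℝ≥0, Summable fun s : Ioc (0 : ℝ≥0) t =>
    (X s ω - Function.leftLim (fun u => X u ω) s) ^ 2) ∧
  ∀ t : ℝ≥0, TendstoInMeasure P
    (fun (n : ℕ) ω => ∑ k ∈ Finset.range n,
      (X (t * ((k : ℝ≥0) + 1) / (n : ℝ≥0)) ω - X (t * (k : ℝ≥0) / (n : ℝ≥0)) ω) ^ 2)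
    atTop
    (fun ω => A t ω + ∑' s : Ioc (0 : ℝ≥0) t,
      (X s ω - Function.leftLim (fun u => X u ω) s) ^ 2)

/-- `L` is the symmetric local time of `X` at the level `y`:
`L_t = lim_{ε ↓ 0} (1 / 2ε) ∫_0^t 1{y - ε < X_s < y + ε} d[X]^c_s` in probability. -/
def IsSymLocalTime (P : Measure Ω) (X : ℝ≥0 → Ω → ℝ) (y : ℝ) (L : ℝ≥0 → Ω → ℝ) : Prop :=
  (∀ᵐ ω ∂P, Monotone (fun t => L t ω) ∧ Continuous (fun t => L t ω) ∧ L 0 ω = 0) ∧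
  ∃ A : ℝ≥0 → Ω → ℝ, IsContQuadVar P X A ∧
    ∀ t : ℝ≥0, TendstoInMeasure P
      (fun (ε : ℝ) ω => (2 * ε)⁻¹ *
        (lsMeasure fun u => A u ω).real {s | s ∈ Ioc 0 t ∧ y - ε < X s ω ∧ X s ω < y + ε})
      (𝓝[>] 0) (fun ω => L t ω)

open scoped Classical in
/-- The symmetric local time `L^y(X)`, a process determined up to indistinguishability
(value `0` if it does not exist; solutions of the state equation are required to possess the
local times that occur in it). -/
def symLocalTime (P : Measure Ω) (X : ℝ≥0 → Ω → ℝ) (y : ℝ) : ℝ≥0 → Ω → ℝ :=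
  if h : ∃ L, IsSymLocalTime P X y L then h.choose else 0

end Stochastic

/-! ### Admissible control strategies -/

/-- Admissible control strategies. Functions on `[0, ∞)` are represented by functions on `ℝ`, of
which only the values on `[0, ∞)` are constrained and used. The interior of the jump set is its
interior as a subset of `ℝ` (so that the interior of `[0, ∞)` is `(0, ∞)`). -/
structure Strategy where
  /-- the extraction rate `λ` -/
  rate : ℝ → ℝ
  rate_measurable : Measurable ((Ici (0 : ℝ)).domRestrict rate)
  rate_nonneg : ∀ x, 0 ≤ x → 0 ≤ rate x
  /-- the jump set `B` -/
  jumpSet : Set ℝ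
  jumpSet_subset : jumpSet ⊆ Ici 0
  jumpSet_finite_union : ∃ 𝒮 : Set (Set ℝ), 𝒮.Finite ∧
    (∀ S ∈ 𝒮, IsClosed S ∧ IsPreconnected S) ∧ jumpSet = ⋃₀ 𝒮
  /-- the jump size `𝒥` -/
  jump : ℝ → ℝ
  jump_measurable : Measurable ((Ici (0 : ℝ)).domRestrict jump)
  jump_nonneg : ∀ x, 0 ≤ x → 0 ≤ jump x
  jump_eq_zero : ∀ x, 0 ≤ x → x ∉ jumpSet → jump x = 0
  jump_le : ∀ x, 0 ≤ x → jump x ≤ x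
  jump_pos : ∀ x ∈ interior jumpSet, 0 < jump x
  /-- the number of skew points -/
  numSkew : ℕ
  /-- the skew points `x_j` -/
  skewPoint : Fin numSkew → ℝ
  skewPoint_pos : ∀ j, 0 < skewPoint j
  skewPoint_notMem : ∀ j, skewPoint j ∉ interior jumpSet
  /-- the intensities `c_j` -/
  skewCoeff : Fin numSkew → ℝ
  skewCoeff_pos : ∀ j, 0 < skewCoeff j
  skewCoeff_le_one : ∀ j, skewCoeff j ≤ 1

/-- `α(x) = (x - 𝒥¹(x) - 𝒥²(x)) ∨ 0`. -/
def jumpMap (D : Fin 2 → Strategy) (x : ℝ) : ℝ := max (x - ∑ i, (D i).jump x) 0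

/-- The jump `∑_{k ≥ 0} 𝒥ⁱ(α^k(x))` of the control of player `i` when the state before the jump is
`x ≥ 0`. The terms are non-negative with sum at most `2 x`. -/
def totalJump (D : Fin 2 → Strategy) (i : Fin 2) (x : ℝ) : ℝ :=
  ∑' k : ℕ, (D i).jump ((jumpMap D)^[k] x)

/-! ### The game -/

/-- The data of the game: a filtered probability space with the usual conditions supporting a Wiener
process, coefficients `μ, σ` on `[0, ∞)`, a discount rate `r > 0`, and an RCLL profit rate
`g : [0, ∞) → (0, ∞)`. Only the values of `μ, σ, g` on `[0, ∞)` matter. -/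
structure Model (Ω : Type*) [m : MeasurableSpace Ω] where
  P : Measure Ω
  isProbability : IsProbabilityMeasure P
  ℱ : Filtration ℝ≥0 m
  rightContinuous : ℱ.IsRightContinuous
  /-- Every `P`-null set belongs to `ℱ_0`; in particular `P` is complete. -/
  nullSets : ∀ s : Set Ω, P s = 0 → MeasurableSet[ℱ 0] s
  W : ℝ≥0 → Ω → ℝ
  isWiener : IsWiener P ℱ W
  μ : ℝ → ℝ
  μ_measurable : Measurable ((Ici (0 : ℝ)).domRestrict μ)
  σ : ℝ → ℝ
  σ_measurable : Measurable ((Ici (0 : ℝ)).domRestrict σ)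
  r : ℝ
  r_pos : 0 < r
  g : ℝ → ℝ
  g_pos : ∀ x, 0 ≤ x → 0 < g x
  g_rightContinuous : ∀ x, 0 ≤ x → ContinuousWithinAt g (Ici x) x
  g_leftLimit : ∀ x, 0 < x → ∃ l, Tendsto g (𝓝[<] x) (𝓝 l)

namespace Model

variable {Ω : Type*} [MeasurableSpace Ω] (M : Model Ω)

/-- `G(x) = ∫_0^x g(u) du`. -/
def G (x : ℝ) : ℝ := ∫ u in (0 : ℝ)..x, M.g u

/-- The control process of player `i` when the state process is `X` with `X_{0-} = x`, stopped at
absorption: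
`Dⁱ_t = ∫_0^{t∧τ} λⁱ(X_s) ds + ∑_j cⁱ_j L^{xⁱ_j}_{t∧τ}(X) + ∑_{0 ≤ s ≤ t∧τ} ∑_k 𝒥ⁱ(α^k(X_{s-}))`. -/
def control (D : Fin 2 → Strategy) (x : ℝ) (X : ℝ≥0 → Ω → ℝ) (i : Fin 2) (t : ℝ≥0) (ω : Ω) : ℝ :=
  (∫ s in Iio (stopAt (fun u => X u ω) t), (D i).rate (X s ω) ∂leb) +
  (∑ j, (D i).skewCoeff j *
    symLocalTime M.P X ((D i).skewPoint j) (stopAt (fun u => X u ω) t) ω) +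
  ∑' s : Iic (stopAt (fun u => X u ω) t), totalJump D i (leftVal x (fun u => X u ω) s)

/-- `X` solves the controlled state equation
`dX = μ(X) dt + σ(X) dW - dD¹ - dD²`, `X_{0-} = x`, on `[0, τ]`, and is stopped at `τ`. -/
structure IsSolution (D : Fin 2 → Strategy) (x : ℝ) (X : ℝ≥0 → Ω → ℝ) : Prop where
  adapted : Adapted M.ℱ X
  rcll : ∀ᵐ ω ∂M.P, IsRCLL fun t => X t ω
  exists_localTime : ∀ i j, ∃ L, IsSymLocalTime M.P X ((D i).skewPoint j) L
  integrable_drift : ∀ᵐ ω ∂M.P, ∀ t,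
    IntegrableOn (fun s => M.μ (X s ω)) (Iio (stopAt (fun u => X u ω) t)) leb
  integrable_rate : ∀ᵐ ω ∂M.P, ∀ i t,
    IntegrableOn (fun s => (D i).rate (X s ω)) (Iio (stopAt (fun u => X u ω) t)) leb
  summable_jump : ∀ᵐ ω ∂M.P, ∀ i t, Summable fun s : Iic (stopAt (fun u => X u ω) t) =>
    totalJump D i (leftVal x (fun u => X u ω) s)
  equation : ∃ I : ℝ≥0 → Ω → ℝ,
    IsItoIntegral M.P M.ℱ M.W
      (fun s ω => {s : ℝ≥0 | (s : ℝ≥0∞) < absorptionTime fun u => X u ω}.indicator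
        (fun s => M.σ (X s ω)) s) I ∧
    ∀ᵐ ω ∂M.P, ∀ t, X t ω =
      x + (∫ s in Iio (stopAt (fun u => X u ω) t), M.μ (X s ω) ∂leb) +
        I (stopAt (fun u => X u ω) t) ω - ∑ i, M.control D x X i t ω

/-- A strong solution: a solution adapted to the augmentation by null sets of the filtration
generated by `W`. -/
def IsStrongSolution (D : Fin 2 → Strategy) (x : ℝ) (X : ℝ≥0 → Ω → ℝ) : Prop :=
  M.IsSolution D x X ∧ ∀ t, AEStronglyMeasurable[
    ⨆ s : Iic t, MeasurableSpace.comap (M.W s) inferInstance] (X t) M.P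

/-- Unique strong solvability: there is a strong solution, and any two solutions are indistinguishable. -/
def HasUniqueStrongSolution (D : Fin 2 → Strategy) (x : ℝ) : Prop :=
  (∃ X, M.IsStrongSolution D x X) ∧
  ∀ X Y : ℝ≥0 → Ω → ℝ, M.IsSolution D x X → M.IsSolution D x Y → ∀ᵐ ω ∂M.P, ∀ t, X t ω = Y t ω

/-- The jump `Δd_t = d_t - d_{t-}` of a control path, with `d_{0-} = 0`. -/
def jumpAt (d : ℝ≥0 → ℝ) (t : ℝ≥0) : ℝ := d t - leftVal 0 d t

/-- The continuous part of a control path: `d_t - ∑_{0 ≤ s ≤ t} Δd_s`. -/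
def contPart (d : ℝ≥0 → ℝ) (t : ℝ≥0) : ℝ := d t - ∑' s : Iic t, jumpAt d s

/-- The discounted payoff `∫_{[0,τ]} e^{-rt} g(X_{t-}) ∘ dDⁱ_t` along a state path `f` with
`f (0-) = x` and control paths `d 0`, `d 1`. -/
def pathPayoff (x : ℝ) (f : ℝ≥0 → ℝ) (d : Fin 2 → ℝ≥0 → ℝ) (i : Fin 2) : ℝ≥0∞ :=
  (∫⁻ t in {t : ℝ≥0 | (t : ℝ≥0∞) ≤ absorptionTime f},
    ENNReal.ofReal (Real.exp (-M.r * t) *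
      ((M.g (leftVal x f t) + Function.leftLim M.g (leftVal x f t)) / 2))
    ∂(lsMeasure (contPart (d i)))) +
  ∑' t : {t : ℝ≥0 | (t : ℝ≥0∞) ≤ absorptionTime f},
    ENNReal.ofReal (Real.exp (-M.r * (t : ℝ≥0)) *
      (jumpAt (d i) t / (∑ j, jumpAt (d j) t) *
        (M.G (leftVal x f t) - M.G (max (leftVal x f t - ∑ j, jumpAt (d j) t) 0))))

open scoped Classical in
/-- The expected reward `J_i(x; D¹, D²)` in `[-∞, ∞]`, which is `-∞` if the state equation has no
unique strong solution. -/
def expectedReward (i : Fin 2) (x : ℝ) (D : Fin 2 → Strategy) : EReal :=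
  if h : M.HasUniqueStrongSolution D x then
    ((∫⁻ ω, M.pathPayoff x (fun t => h.1.choose t ω)
      (fun j t => M.control D x h.1.choose j t ω) i ∂M.P : ℝ≥0∞) : EReal)
  else ⊥

/-- Global Markovian Nash equilibrium: no unilateral deviation to an admissible strategy improves
the expected reward of the deviating player, for any initial state `x ≥ 0`. -/
def IsGlobalMarkovNash (D : Fin 2 → Strategy) : Prop :=
  ∀ (i : Fin 2) (D' : Strategy) (x : ℝ), 0 ≤ x →
    M.expectedReward i x (Function.update D i D') ≤ M.expectedReward i x D

end Model

end ExtractionGame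

end

/-!
If at least one player extracts the whole resource at once (`𝒥ʲ(x) = x` on `[0, ∞)`), the game ends
at time `0`. Indeed `α(x) = (x - 𝒥¹(x) - 𝒥²(x)) ∨ 0 = 0` for `x ≥ 0`, so that the iterated jumps
end after the first one, `X_0 = x - 𝒥¹(x) - 𝒥²(x) ≤ 0` and `τ = 0`. Every solution is therefore
almost surely the constant path `x - 𝒥¹(x) - 𝒥²(x)`, which gives uniqueness
(`IsSolution.ae_eq_afterJump`); conversely this constant path is a strong solution, all local times
and stochastic integrals being zero (`isStrongSolution_afterJump`).

The reward of player `i` reduces to the single jump at time `0`,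
`𝒥ⁱ(x) / (𝒥¹(x) + 𝒥²(x)) * G(x)` (`expectedReward_eq`). If both players extract everything, this is
`G(x) / 2`. If the opponent extracts everything and player `i` deviates, it is
`𝒥ⁱ(x) / (x + 𝒥ⁱ(x)) * G(x) ≤ G(x) / 2`, because `𝒥ⁱ(x) ≤ x` (`share_mul_G_le`). The state equation
stays uniquely solvable under such a deviation, so the value `-∞` does not occur, and no deviation is
profitable.
-/

open MeasureTheory ProbabilityTheory Filter Topology Set
open scoped NNReal ENNReal

noncomputable section

namespace ExtractionGame

/-! ### Constant paths and paths absorbed at time `0` -/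

lemma leftLim_const (c : ℝ) (t : ℝ≥0) : Function.leftLim (fun _ : ℝ≥0 => c) t = c :=
  ContinuousWithinAt.leftLim_eq continuousWithinAt_const

lemma isRCLL_const (c : ℝ) : IsRCLL fun _ => c :=
  fun _ => ⟨continuousWithinAt_const, c, tendsto_const_nhds⟩

lemma lsMeasure_const (c : ℝ) : lsMeasure (fun _ => c) = 0 := by
  rw [lsMeasure, dif_pos monotone_const]
  have : (monotone_const (c := c) : Monotone fun _ : ℝ≥0 => c).stieltjesFunction
      = StieltjesFunction.const ℝ≥0 c := by
    ext t
    rw [Monotone.stieltjesFunction_eq]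
    exact ContinuousWithinAt.rightLim_eq continuousWithinAt_const
  rw [this, StieltjesFunction.measure_const]

lemma absorptionTime_eq_zero {f : ℝ≥0 → ℝ} (h : f 0 ≤ 0) : absorptionTime f = 0 :=
  nonpos_iff_eq_zero.1 (iInf₂_le_of_le 0 h (by simp))

lemma stopAt_eq_zero {f : ℝ≥0 → ℝ} (h : absorptionTime f = 0) (t : ℝ≥0) : stopAt f t = 0 := by
  simp [stopAt, h]

lemma stopAt_zero (f : ℝ≥0 → ℝ) : stopAt f 0 = 0 := by
  simp [stopAt]

lemma Iio_zero_nnreal : Iio (0 : ℝ≥0) = ∅ := by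
  ext t; simp

lemma tsum_Iic_zero (F : ℝ≥0 → ℝ) : ∑' s : Iic (0 : ℝ≥0), F s = F 0 := by
  have h0 : Iic (0 : ℝ≥0) = {0} := by ext t; simp
  rw [h0, tsum_singleton 0 F]

lemma leftVal_zero (a : ℝ) (f : ℝ≥0 → ℝ) : leftVal a f 0 = a := if_pos rfl

namespace Model

lemma jumpAt_const_zero (c : ℝ) : jumpAt (fun _ => c) 0 = c := by
  simp [jumpAt, leftVal_zero]

lemma jumpAt_const_of_ne (c : ℝ) {t : ℝ≥0} (ht : t ≠ 0) : jumpAt (fun _ => c) t = 0 := by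
  simp [jumpAt, leftVal, ht, leftLim_const]

/-- A control path that is constant from time `0` on consists of its jump at time `0` only. -/
lemma contPart_const (c : ℝ) : contPart (fun _ => c) = fun _ => 0 := by
  funext t
  rw [contPart, tsum_eq_single (⟨0, mem_Iic.2 zero_le⟩ : Iic t)]
  · simp [jumpAt_const_zero]
  · intro s hs
    exact jumpAt_const_of_ne c fun h => hs (Subtype.ext h)

end Model

/-! ### Local times and stochastic integrals of constant paths -/

section Stochastic

variable {Ω : Type*} {m : MeasurableSpace Ω}

lemma isContQuadVar_const (P : Measure Ω) (c : ℝ) :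
    IsContQuadVar P (fun _ _ => c) (fun _ _ => 0) := by
  refine ⟨ae_of_all _ fun _ => ⟨monotone_const, continuous_const, rfl⟩,
    ae_of_all _ fun _ t => ?_, fun t => ?_⟩
  · simp [leftLim_const]
  · simp only [leftLim_const, sub_self, ne_eq, OfNat.ofNat_ne_zero, not_false_eq_true, zero_pow,
      Finset.sum_const_zero, tsum_zero, add_zero]
    intro ε hε
    simp [hε.ne']

lemma isSymLocalTime_const (P : Measure Ω) (c y : ℝ) :
    IsSymLocalTime P (fun _ _ => c) y (fun _ _ => 0) := by
  refine ⟨ae_of_all _ fun _ => ⟨monotone_const, continuous_const, rfl⟩, _,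
    isContQuadVar_const P c, fun t => ?_⟩
  intro ε hε
  simp [lsMeasure_const, hε.ne']

/-- The local time chosen by `symLocalTime` starts from zero, whether or not it exists. -/
lemma ae_symLocalTime_zero (P : Measure Ω) (X : ℝ≥0 → Ω → ℝ) (y : ℝ) :
    ∀ᵐ ω ∂P, symLocalTime P X y 0 ω = 0 := by
  by_cases h : ∃ L, IsSymLocalTime P X y L
  · rw [symLocalTime, dif_pos h]
    filter_upwards [h.choose_spec.1] with ω hω using hω.2.2
  · rw [symLocalTime, dif_neg h]
    exact ae_of_all _ fun _ => rfl

lemma isItoIntegral_zero (P : Measure Ω) (ℱ : Filtration ℝ≥0 m) (W : ℝ≥0 → Ω → ℝ) :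
    IsItoIntegral P ℱ W (fun _ _ => 0) (fun _ _ => 0) := by
  refine ⟨fun _ => measurable_const, ae_of_all _ fun _ => ⟨continuous_const, rfl⟩,
    fun _ => ⟨0, fun _ => 0, monotone_const, fun _ _ => 0, fun _ => measurable_const,
      0, by simp⟩, fun T => ⟨fun ε hε => ?_, fun ε hε => ?_⟩⟩
  · simp [SimpleIntegrand.value, hε.ne']
  · simp [SimpleIntegrand.integral, hε.not_ge]

end Stochastic

/-! ### Strategies with full extraction -/

lemma Strategy.jump_zero (S : Strategy) : S.jump 0 = 0 :=
  le_antisymm (S.jump_le 0 le_rfl) (S.jump_nonneg 0 le_rfl)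

section FullExtraction

variable {D : Fin 2 → Strategy} {j : Fin 2} {x : ℝ}

lemma le_sum_jump (hj : (D j).jump x = x) (hx : 0 ≤ x) : x ≤ ∑ i, (D i).jump x :=
  calc x = (D j).jump x := hj.symm
    _ ≤ ∑ i, (D i).jump x :=
      Finset.single_le_sum (f := fun i => (D i).jump x)
        (fun i _ => (D i).jump_nonneg x hx) (Finset.mem_univ j)

/-- If one player extracts everything, the state is depleted by the first round of jumps and the
later rounds do not contribute. -/
lemma totalJump_eq_jump (hj : (D j).jump x = x) (hx : 0 ≤ x) (i : Fin 2) :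
    totalJump D i x = (D i).jump x := by
  have h0 : jumpMap D 0 = 0 := by simp [jumpMap, Strategy.jump_zero]
  have h1 : jumpMap D x = 0 := max_eq_right (sub_nonpos.2 (le_sum_jump hj hx))
  rw [totalJump, tsum_eq_single 0]
  · rfl
  · intro k hk
    obtain ⟨n, rfl⟩ := Nat.exists_eq_succ_of_ne_zero hk
    rw [Function.iterate_succ_apply, h1, Function.iterate_fixed h0, Strategy.jump_zero]

/-- The state `x - 𝒥¹(x) - 𝒥²(x)` after one round of jumps from `x`, not truncated at `0`. -/
def afterJump (D : Fin 2 → Strategy) (x : ℝ) : ℝ := x - ∑ i, (D i).jump x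

lemma afterJump_nonpos (hj : (D j).jump x = x) (hx : 0 ≤ x) : afterJump D x ≤ 0 :=
  sub_nonpos.2 (le_sum_jump hj hx)

namespace Model

variable {Ω : Type*} [MeasurableSpace Ω] (M : Model Ω)

/-- While the stopped clock is still at `0`, the control of each player is its initial jump. -/
lemma ae_control_eq (hj : (D j).jump x = x) (hx : 0 ≤ x) (X : ℝ≥0 → Ω → ℝ) :
    ∀ᵐ ω ∂M.P, ∀ i t, stopAt (fun u => X u ω) t = 0 →
      M.control D x X i t ω = (D i).jump x := by
  have hL : ∀ᵐ ω ∂M.P, ∀ i k, symLocalTime M.P X ((D i).skewPoint k) 0 ω = 0 :=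
    ae_all_iff.2 fun _ => ae_all_iff.2 fun _ => ae_symLocalTime_zero _ _ _
  filter_upwards [hL] with ω hω i t ht
  have hs := tsum_Iic_zero fun s => totalJump D i (leftVal x (fun u => X u ω) s)
  simp only [leftVal_zero, totalJump_eq_jump hj hx] at hs
  rw [control, ht, hs, Iio_zero_nnreal]
  simp [hω]

/-- If one player extracts everything, every solution of the state equation is absorbed at time `0`
and stays where the initial jumps put it. -/
lemma IsSolution.ae_eq_afterJump (hj : (D j).jump x = x) (hx : 0 ≤ x) {X : ℝ≥0 → Ω → ℝ}
    (hX : M.IsSolution D x X) :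
    ∀ᵐ ω ∂M.P, absorptionTime (fun t => X t ω) = 0 ∧ (∀ t, X t ω = afterJump D x) ∧
      ∀ i t, M.control D x X i t ω = (D i).jump x := by
  obtain ⟨I, hI, hEq⟩ := hX.equation
  filter_upwards [hI.2.1, hEq, M.ae_control_eq hj hx X] with ω hI0 hω hc
  have hclock : ∀ t, stopAt (fun u => X u ω) t = 0 → X t ω = afterJump D x := by
    intro t ht
    rw [hω t, ht, Iio_zero_nnreal, hI0.2]
    simp [afterJump, hc _ t ht]
  have hτ : absorptionTime (fun t => X t ω) = 0 := absorptionTime_eq_zero <|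
    (hclock 0 (stopAt_zero _)).trans_le (afterJump_nonpos hj hx)
  exact ⟨hτ, fun t => hclock t (stopAt_eq_zero hτ t), fun i t => hc i t (stopAt_eq_zero hτ t)⟩

lemma isStrongSolution_afterJump (hj : (D j).jump x = x) (hx : 0 ≤ x) :
    M.IsStrongSolution D x (fun _ _ => afterJump D x) := by
  have hτ : absorptionTime (fun _ => afterJump D x) = 0 :=
    absorptionTime_eq_zero (afterJump_nonpos hj hx)
  have hclock := stopAt_eq_zero hτ
  refine ⟨⟨fun _ => measurable_const, ae_of_all _ fun _ => isRCLL_const _,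
    fun i k => ⟨_, isSymLocalTime_const M.P _ _⟩, ae_of_all _ fun ω t => ?_,
    ae_of_all _ fun ω i t => ?_, ae_of_all _ fun ω i t => ?_, fun _ _ => 0, ?_, ?_⟩,
    fun _ => aestronglyMeasurable_const⟩
  · rw [hclock, Iio_zero_nnreal]; exact integrableOn_empty
  · rw [hclock, Iio_zero_nnreal]; exact integrableOn_empty
  · have : Finite (Iic (stopAt (fun _ => afterJump D x) t)) := by
      rw [hclock, ← bot_eq_zero, Iic_bot]; infer_instance
    exact Summable.of_finite
  · simpa [hτ] using isItoIntegral_zero M.P M.ℱ M.W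
  · filter_upwards [M.ae_control_eq hj hx (fun _ _ => afterJump D x)] with ω hc t
    have hsum : ∑ i, M.control D x (fun _ _ => afterJump D x) i t ω = ∑ i, (D i).jump x :=
      Finset.sum_congr rfl fun i _ => hc i t (hclock t)
    rw [hsum, hclock, Iio_zero_nnreal]
    simp [afterJump]

lemma hasUniqueStrongSolution (hj : (D j).jump x = x) (hx : 0 ≤ x) :
    M.HasUniqueStrongSolution D x := by
  refine ⟨⟨_, M.isStrongSolution_afterJump hj hx⟩, fun X Y hX hY => ?_⟩
  filter_upwards [hX.ae_eq_afterJump M hj hx, hY.ae_eq_afterJump M hj hx] with ω h1 h2 t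
  rw [h1.2.1, h2.2.1]

/-! ### Rewards -/

lemma G_zero : M.G 0 = 0 := intervalIntegral.integral_same

lemma G_nonneg (hx : 0 ≤ x) : 0 ≤ M.G x :=
  intervalIntegral.integral_nonneg hx fun u hu => (M.g_pos u hu.1).le

/-- If the state is absorbed at time `0` and each control consists of an initial jump `a i`, only
the lump-sum reward at time `0` remains. -/
lemma pathPayoff_const (f : ℝ≥0 → ℝ) (hf : absorptionTime f = 0) (a : Fin 2 → ℝ) (i : Fin 2) :
    M.pathPayoff x f (fun k _ => a k) i =
      ENNReal.ofReal (a i / (∑ k, a k) * (M.G x - M.G (max (x - ∑ k, a k) 0))) := by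
  have hset : {t : ℝ≥0 | (t : ℝ≥0∞) ≤ absorptionTime f} = {0} := by
    ext t; simp [hf]
  rw [pathPayoff, contPart_const, lsMeasure_const, hset, tsum_singleton (0 : ℝ≥0) fun t : ℝ≥0 =>
    ENNReal.ofReal (Real.exp (-M.r * t) * (jumpAt (fun _ => a i) t /
      (∑ k, jumpAt (fun _ => a k) t) * (M.G (leftVal x f t) -
        M.G (max (leftVal x f t - ∑ k, jumpAt (fun _ => a k) t) 0))))]
  simp [jumpAt_const_zero, leftVal_zero]

/-- If one player extracts everything, the players share `G x` in proportion to their initial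
jumps. For `x = 0` the share is the junk value `0 / 0 = 0`, which is harmless since `G 0 = 0`. -/
lemma expectedReward_eq (hj : (D j).jump x = x) (hx : 0 ≤ x) (i : Fin 2) :
    M.expectedReward i x D = (((D i).jump x / (∑ k, (D k).jump x) * M.G x : ℝ) : EReal) := by
  have := M.isProbability
  have h := M.hasUniqueStrongSolution hj hx
  rw [expectedReward, dif_pos h]
  have hpath : ∀ᵐ ω ∂M.P, M.pathPayoff x (fun t => h.1.choose t ω)
      (fun k t => M.control D x h.1.choose k t ω) i =
      ENNReal.ofReal ((D i).jump x / (∑ k, (D k).jump x) * M.G x) := by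
    filter_upwards [h.1.choose_spec.1.ae_eq_afterJump M hj hx] with ω ⟨hτ, _, hc⟩
    simp only [hc]
    rw [M.pathPayoff_const _ hτ, max_eq_right (sub_nonpos.2 (le_sum_jump hj hx)), G_zero, sub_zero]
  rw [lintegral_congr_ae hpath, lintegral_const, measure_univ, mul_one, EReal.coe_ennreal_ofReal,
    max_eq_left]
  exact mul_nonneg (div_nonneg ((D i).jump_nonneg x hx)
    (Finset.sum_nonneg fun k _ => (D k).jump_nonneg x hx)) (M.G_nonneg hx)

/-- Against an opponent who extracts everything, no strategy earns more than half of `G x`. -/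
lemma share_mul_G_le (hx : 0 ≤ x) {i : Fin 2} (hij : i ≠ j) (hj : (D j).jump x = x) :
    (D i).jump x / (∑ k, (D k).jump x) * M.G x ≤ M.G x / 2 := by
  have hsum : ∑ k, (D k).jump x = (D i).jump x + x := by
    rw [← hj, Fin.sum_univ_two]
    fin_cases i <;> fin_cases j <;> simp_all [add_comm]
  have h0 := (D i).jump_nonneg x hx
  have hle : (D i).jump x / (∑ k, (D k).jump x) ≤ 1 / 2 := by
    rw [hsum]
    apply div_le_of_le_mul₀ (by positivity) (by norm_num)
    linarith [(D i).jump_le x hx]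
  calc _ ≤ 1 / 2 * M.G x := mul_le_mul_of_nonneg_right hle (M.G_nonneg hx)
    _ = M.G x / 2 := by ring

lemma expectedReward_of_full (hJ : ∀ i, (D i).jump x = x) (hx : 0 ≤ x) (i : Fin 2) :
    M.expectedReward i x D = ((M.G x / 2 : ℝ) : EReal) := by
  rw [M.expectedReward_eq (hJ 0) hx i]
  congr 1
  rcases hx.eq_or_lt with rfl | hpos
  · simp [G_zero]
  · simp only [hJ, Fin.sum_univ_two]
    field_simp
    ring

end Model

end FullExtraction

end ExtractionGame

end

theorem theorem4p3 {Ω : Type*} [MeasurableSpace Ω] (M : ExtractionGame.Model Ω)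
    (D : Fin 2 → ExtractionGame.Strategy)
    (hB : ∀ i, (D i).jumpSet = Set.Ici 0)
    (hJ : ∀ i, ∀ x : ℝ, 0 ≤ x → (D i).jump x = x) :
    (∀ x : ℝ, 0 ≤ x → M.HasUniqueStrongSolution D x ∧
      ∀ X : ℝ≥0 → Ω → ℝ, M.IsSolution D x X →
        ∀ᵐ ω ∂M.P, (∀ i, M.control D x X i 0 ω = x) ∧
          ExtractionGame.absorptionTime (fun t => X t ω) = 0) ∧
    M.IsGlobalMarkovNash D ∧
    ∀ (i : Fin 2) (x : ℝ), 0 ≤ x →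
      M.expectedReward i x D = ((M.G x / 2 : ℝ) : EReal) := by
  refine ⟨fun x hx => ⟨M.hasUniqueStrongSolution (hJ 0 x hx) hx, fun X hX => ?_⟩, ?_,
    fun i x hx => M.expectedReward_of_full (fun k => hJ k x hx) hx i⟩
  · filter_upwards [hX.ae_eq_afterJump M (hJ 0 x hx) hx] with ω ⟨hτ, _, hc⟩
    exact ⟨fun i => (hc i 0).trans (hJ i x hx), hτ⟩
  · intro i D' x hx
    obtain ⟨j, hji⟩ := exists_ne i
    have hj : (Function.update D i D' j).jump x = x := by
      rw [Function.update_of_ne hji]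
      exact hJ j x hx
    rw [M.expectedReward_of_full (fun k => hJ k x hx) hx i, M.expectedReward_eq hj hx i]
    exact EReal.coe_le_coe_iff.2 (M.share_mul_G_le hx hji.symm hj)
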